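/- \textbf{Setting.} Let $L\ge 1$, $p,q>0$, $p+q=1$, and $\alpha=pq$. In the one-dimensional Directed Stochastic Sandpile on the sites $1,\dots,L$, a generalised configuration is a pair $(w,z)$ with $w(x)\in\mathbb N$ waiting particles and $z(x)\in\{0,1\}$ stable particles on site $x$; it is stable if $w=0$. Writing $a_x$ for one waiting particle on $x$, one waiting particle at a site $x$ evolves by $$a_x[1_x]\to a_x a_{x+1}[0_x],\qquad a_x[0_x]\to p\,[1_x]+q\,a_{x+1}[0_x],$$ with $a_{L+1}=1$ (particles leave at the right end). Each transfer of a particle from $x$ to $x+1$ is one toppling at $x$. From a stable configuration $r\in\{0,1\}^L$, an avalanche is obtained by adding one waiting particle at site $1$ and evolving waiting particles one at a time, in the order given by an arbitrary fixed rule that selects a site with a waiting particle in each unstable configuration, until the configuration is stable. Let $s(x)$ be the number of topplings at $x$ in the avalanche, $W(r\to r')$ the probability that the avalanche from $r$ ends in $r'$ (as a matrix, $W$ acts on column vectors: $\langle r'|W|r\rangle=W(r\to r')$), $\psi=\bigotimes_{x=1}^L(p[1_x]+q[0_x])$ the stationary state, and $\langle \mathrm{Id}|=\sum_{r}\langle r|$.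 Start from $\psi$, trigger successive avalanches at times $0,1,2,\dots$, and let $s(x,t)$ be the number of topplings at $x$ in the avalanche at time $t$. \textbf{Statement.} For $1\le x\le L$ and stable configurations $r,r'$ with particle numbers $z^r(y),z^{r'}(y)$, put $$W_x^{0}(r\to r')=\delta\Big(1+\sum_{y\le x}z^r(y),\ \sum_{y\le x}z^{r'}(y)\Big)\,W(r\to r'),$$ $$W_x^{\ge1}(r\to r')=\Big(1-\delta\Big(1+\sum_{y\le x}z^r(y),\ \sum_{y\le x}z^{r'}(y)\Big)\Big)\,W(r\to r'),$$ where $\delta$ is the Kronecker delta. Then $W=W_x^0+W_x^{\ge1}$; moreover $W_x^0(r\to r')$ is the probability that the avalanche from $r$ ends in $r'$ with no toppling at $x$, and $W_x^{\ge 1}(r\to r')$ is the probability that it ends in $r'$ with at least one toppling at $x$. Furthermore, for all $2\le x\le L$, $t\ge0$ and $\tau\ge1$, $$\langle s(x,t)s(x,t+\tau)\rangle=\langle s(x-1,t)s(x-1,t+\tau)\rangle-\alpha\,\langle \mathrm{Id}|\,W_{x-1}^{\ge1}\,(W_{x-1}^{0})^{\tau-1}\,W_{x-1}^{\ge1}\,|\psi\rangle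 .$$ -/

import Mathlib

/-! The one-dimensional Directed Stochastic Sandpile on a chain of `L` sites, driven at its first
site and dissipating at its last one. Sites are the elements of `Fin L`, listed from left to right;
the element with value `i` is the site number `i + 1` of the chain. -/

namespace DSS

noncomputable section

/-- Stable configurations `z ∈ {0,1}^L`; `true` means one stable particle. -/
abbrev Stable (L : ℕ) := Fin L → Bool

/-- Generalised configurations `(w, z)`: numbers of waiting particles, and stable particles. -/
abbrev Config (L : ℕ) := (Fin L → ℕ) × Stable L

/-- A generalised configuration together with the number of topplings made so far at each site. -/
abbrev Record (L : ℕ) := Config L × (Fin L → ℕ)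

/-- No waiting particle is left. -/
def IsStable {L : ℕ} (c : Config L) : Prop := ∀ x, c.1 x = 0

/-- Add one waiting particle to the right neighbour of `x`. At the last site the particle
leaves the system. -/
def addRight {L : ℕ} (x : Fin L) (w : Fin L → ℕ) : Fin L → ℕ :=
  fun y => if (y : ℕ) = (x : ℕ) + 1 then w y + 1 else w y

/-- Count one more toppling at `x`. -/
def countAt {L : ℕ} (x : Fin L) (s : Fin L → ℕ) : Fin L → ℕ :=
  Function.update s x (s x + 1)

/-- Remove one waiting particle from `x`. -/
def removeAt {L : ℕ} (x : Fin L) (w : Fin L → ℕ) : Fin L → ℕ :=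
  Function.update w x (w x - 1)

/-- The local rules, for one waiting particle at site `x`:
`a_x [1] → a_x a_{x+1} [0]` and `a_x [0] → p [1] + q a_{x+1} [0]`.
A transfer of a particle from `x` to its right neighbour is a toppling at `x`. -/
def stepAt {L : ℕ} (p q : ℝ) (x : Fin L) (c : Record L) : Record L →₀ ℝ :=
  if c.1.2 x = true then
    Finsupp.single ((addRight x c.1.1, Function.update c.1.2 x false), countAt x c.2) 1
  else
    Finsupp.single ((removeAt x c.1.1, Function.update c.1.2 x true), c.2) p
      + Finsupp.single ((addRight x (removeAt x c.1.1), c.1.2), countAt x c.2) q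

/-- An evolution rule selects, in each configuration that is not stable, a site with a waiting
particle, which is the one to be evolved. -/
structure EvolutionRule (L : ℕ) where
  site : Config L → Fin L
  legal : ∀ c : Config L, ¬ IsStable c → 0 < c.1 (site c)

open Classical in
/-- The evolution operator of a rule, on formal combinations of configurations: it evolves exactly
one waiting particle of each configuration which is not stable, and fixes the stable ones. -/
def evolve {L : ℕ} (p q : ℝ) (σ : EvolutionRule L) :
    (Record L →₀ ℝ) →ₗ[ℝ] (Record L →₀ ℝ) :=
  Finsupp.linearCombination ℝ fun c : Record L =>
    if IsStable c.1 then Finsupp.single c 1 else stepAt p q (σ.site c.1) c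

/-- A quantity that decreases at each application of a local rule. -/
def potential {L : ℕ} (c : Config L) : ℕ :=
  ∑ x : Fin L, (2 * (L - (x : ℕ)) * c.1 x + (2 * (L - (x : ℕ)) - 1) * (c.2 x).toNat)

/-- `E^∞`: the evolution operator iterated, from the configuration `c`, until everything is stable.
The number of iterations is sufficient, and further ones change nothing: see
`stabilise_stable` and `evolve_iterate_stabilise`. -/
def stabilise {L : ℕ} (p q : ℝ) (σ : EvolutionRule L) (c : Record L) : Record L →₀ ℝ :=
  (evolve p q σ)^[potential c.1] (Finsupp.single c 1)

/-- `a_1 r`: one waiting particle is added at the first site of the stable configuration `r`,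
and no toppling has been made yet. -/
def inject {L : ℕ} (r : Stable L) : Record L :=
  ((fun x => if (x : ℕ) = 0 then 1 else 0, r), fun _ => 0)

/-- The joint law, for the avalanche started from the stable configuration `r`, of the numbers of
topplings `(s(x))_x` in the avalanche and of the stable configuration that it leaves. -/
def avalanche {L : ℕ} (p q : ℝ) (σ : EvolutionRule L) (r : Stable L) :
    ((Fin L → ℕ) × Stable L) →₀ ℝ :=
  (stabilise p q σ (inject r)).mapDomain fun c => (c.2, c.1.2)

open Classical in
/-- The probability that the avalanche started from `r` ends in `r'` and has a vector of
topplings satisfying `A`. -/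
def avalancheProb {L : ℕ} (p q : ℝ) (σ : EvolutionRule L) (r r' : Stable L)
    (A : (Fin L → ℕ) → Prop) : ℝ :=
  (avalanche p q σ r).sum fun k a => if A k.1 ∧ k.2 = r' then a else 0

/-- The transition matrix `W = E^∞ ∘ a_1`; matrices act on column vectors, so the entry
`W r' r` is the transition probability `W(r → r')`. -/
def W {L : ℕ} (p q : ℝ) (σ : EvolutionRule L) : Matrix (Stable L) (Stable L) ℝ :=
  Matrix.of fun r' r => avalancheProb p q σ r r' fun _ => True

/-- The number of stable particles on the sites up to and including `x`. -/
def filling {L : ℕ} (x : Fin L) (r : Stable L) : ℕ :=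
  ∑ y ∈ Finset.Iic x, (r y).toNat

/-- The part `W_x^0` of `W`: the injected particle is still on the sites up to `x`. -/
def WZero {L : ℕ} (p q : ℝ) (σ : EvolutionRule L) (x : Fin L) :
    Matrix (Stable L) (Stable L) ℝ :=
  Matrix.of fun r' r => (if 1 + filling x r = filling x r' then 1 else 0) * W p q σ r' r

/-- The part `W_x^{≥1}` of `W`. -/
def WPos {L : ℕ} (p q : ℝ) (σ : EvolutionRule L) (x : Fin L) :
    Matrix (Stable L) (Stable L) ℝ :=
  Matrix.of fun r' r => (1 - if 1 + filling x r = filling x r' then 1 else 0) * W p q σ r' r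

/-- The stationary state `ψ = ⨂_x (p [1_x] + q [0_x])`. -/
def psi {L : ℕ} (p q : ℝ) : Stable L → ℝ :=
  fun r => ∏ x, if r x = true then p else q

/-- The law of the first `n` successive avalanches started from `ψ`: the topplings `h t x` made at
`x` by the avalanche at time `t < n` (the one started after `t` avalanches), and the stable
configuration after the `n` avalanches. The entries `h t` with `t ≥ n` are `0`. -/
def trajectory {L : ℕ} (p q : ℝ) (σ : EvolutionRule L) :
    ℕ → (((ℕ → Fin L → ℕ) × Stable L) →₀ ℝ)
  | 0 => ∑ r : Stable L, Finsupp.single ((fun _ _ => 0), r) (psi p q r)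
  | n + 1 => Finsupp.linearCombination ℝ
      (fun h : (ℕ → Fin L → ℕ) × Stable L =>
        (avalanche p q σ h.2).mapDomain fun k => (Function.update h.1 n k.1, k.2))
      (trajectory p q σ n)

/-- The two-point function `⟨s(x,t) s(x,t+τ)⟩` in the stationary state. -/
def corr {L : ℕ} (p q : ℝ) (σ : EvolutionRule L) (x : Fin L) (t τ : ℕ) : ℝ :=
  (trajectory p q σ (t + τ + 1)).sum fun h a => a * ((h.1 t x : ℝ) * (h.1 (t + τ) x : ℝ))

/-- `⟨Id | v⟩`, the sum of the coordinates of `v`. -/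
def braId {L : ℕ} (v : Stable L → ℝ) : ℝ := ∑ r, v r

theorem potential_lt {L : ℕ} (p q : ℝ) (x : Fin L) (c : Record L) (hx : 0 < c.1.1 x)
    (d : Record L) (hd : d ∈ (stepAt p q x c).support) : potential d.1 < potential c.1 := by
  classical
  obtain ⟨⟨w, z⟩, s⟩ := c
  simp only at hx
  -- the contribution of the right neighbour
  have hR : ∀ v : Fin L → ℕ, ∀ u : Stable L,
      potential (addRight x v, u) ≤ potential (v, u) + 2 * (L - (x : ℕ) - 1) := by
    intro v u
    by_cases h : (x : ℕ) + 1 < L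
    · have : potential (addRight x v, u)
          = potential (v, u) + ∑ y : Fin L, if y = ⟨(x : ℕ) + 1, h⟩ then 2 * (L - (y : ℕ)) else 0 := by
        unfold potential
        rw [← Finset.sum_add_distrib]
        refine Finset.sum_congr rfl fun y _ => ?_
        by_cases hy : (y : ℕ) = x + 1
        · have hy' : y = ⟨(x : ℕ) + 1, h⟩ := Fin.ext hy
          simp only [addRight, if_pos hy, if_pos hy']; ring
        · have hy' : y ≠ ⟨(x : ℕ) + 1, h⟩ := fun e => hy (by rw [e])
          simp [addRight, hy, hy']
      rw [this]
      simp
      omega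
    · have : addRight x v = v := by
        funext y
        have : (y : ℕ) ≠ x + 1 := by have := y.2; omega
        simp [addRight, this]
      rw [this]; omega
  have hsplit : ∀ (v : Fin L → ℕ) (u : Stable L), potential (v, u)
      = (2 * (L - (x : ℕ)) * v x + (2 * (L - (x : ℕ)) - 1) * (u x).toNat)
        + ∑ y ∈ Finset.univ.erase x,
            (2 * (L - (y : ℕ)) * v y + (2 * (L - (y : ℕ)) - 1) * (u y).toNat) := by
    intro v u
    exact (Finset.add_sum_erase _ _ (Finset.mem_univ x)).symm
  have herase : ∀ (v v' : Fin L → ℕ) (u u' : Stable L), (∀ y, y ≠ x → v y = v' y ∧ u y = u' y) →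
      ∑ y ∈ Finset.univ.erase x,
            (2 * (L - (y : ℕ)) * v y + (2 * (L - (y : ℕ)) - 1) * (u y).toNat)
      = ∑ y ∈ Finset.univ.erase x,
            (2 * (L - (y : ℕ)) * v' y + (2 * (L - (y : ℕ)) - 1) * (u' y).toNat) := by
    intro v v' u u' h
    refine Finset.sum_congr rfl fun y hy => ?_
    obtain ⟨h1, h2⟩ := h y (Finset.ne_of_mem_erase hy)
    rw [h1, h2]
  have hxL := x.2
  obtain ⟨m, hm⟩ : ∃ m, w x = m + 1 := ⟨w x - 1, by omega⟩
  by_cases hz : z x = true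
  · have hd' : d = ((addRight x w, Function.update z x false), countAt x s) := by
      simp only [stepAt, hz, if_true] at hd
      simpa using Finsupp.support_single_subset hd
    subst hd'
    have h1 := hR w (Function.update z x false)
    have h2 := hsplit w (Function.update z x false)
    have h3 := hsplit w z
    rw [herase w w (Function.update z x false) z
      (fun y hy => ⟨rfl, by simp [hy]⟩)] at h2
    simp only [Function.update_self, hz, Bool.toNat_false, Bool.toNat_true] at h2 h3
    simp only
    omega
  · simp only [stepAt, hz] at hd
    have hd' : d = ((removeAt x w, Function.update z x true), s) ∨
        d = ((addRight x (removeAt x w), z), countAt x s) := by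
      rcases Finset.mem_union.1 (Finsupp.support_add hd) with h | h
      · left; simpa using Finsupp.support_single_subset h
      · right; simpa using Finsupp.support_single_subset h
    have hz' : z x = false := by simpa using hz
    have h3 := hsplit w z
    have hrm : removeAt x w x = m := by simp [removeAt, hm]
    have hmul : 2 * (L - (x : ℕ)) * (m + 1) = 2 * (L - (x : ℕ)) * m + 2 * (L - (x : ℕ)) := by ring
    rcases hd' with rfl | rfl
    · have h2 := hsplit (removeAt x w) (Function.update z x true)
      rw [herase (removeAt x w) w (Function.update z x true) z
        (fun y hy => ⟨by simp [removeAt, hy], by simp [hy]⟩), hrm] at h2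
      rw [hm, hmul] at h3
      simp only [Function.update_self, hz', Bool.toNat_false, Bool.toNat_true] at h2 h3
      simp only
      omega
    · have h1 := hR (removeAt x w) z
      have h2 := hsplit (removeAt x w) z
      rw [herase (removeAt x w) w z z (fun y hy => ⟨by simp [removeAt, hy], rfl⟩), hrm] at h2
      rw [hm, hmul] at h3
      simp only [hz', Bool.toNat_false] at h2 h3
      simp only
      omega

theorem evolve_single_of_stable {L : ℕ} (p q : ℝ) (σ : EvolutionRule L) (c : Record L)
    (hc : IsStable c.1) (a : ℝ) :
    evolve p q σ (Finsupp.single c a) = Finsupp.single c a := by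
  simp [evolve, hc]

theorem evolve_of_stable {L : ℕ} (p q : ℝ) (σ : EvolutionRule L) (φ : Record L →₀ ℝ)
    (h : ∀ d ∈ φ.support, IsStable d.1) : evolve p q σ φ = φ := by
  conv_rhs => rw [← Finsupp.sum_single φ]
  conv_lhs => rw [← Finsupp.sum_single φ]
  rw [Finsupp.sum, map_sum]
  exact Finset.sum_congr rfl fun d hd => evolve_single_of_stable p q σ d (h d hd) _

theorem iterate_stable {L : ℕ} (p q : ℝ) (σ : EvolutionRule L) (n : ℕ) :
    ∀ φ : Record L →₀ ℝ, (∀ d ∈ φ.support, IsStable d.1 ∨ potential d.1 ≤ n) →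
      ∀ d ∈ ((evolve p q σ)^[n] φ).support, IsStable d.1 := by
  classical
  induction n with
  | zero =>
    intro φ h d hd
    rcases h d hd with h | h
    · exact h
    · intro x
      have h0 : potential d.1 = 0 := by omega
      have h1 := (Finset.sum_eq_zero_iff.1 h0) x (Finset.mem_univ x)
      have hx := x.2
      have h2 : 2 * (L - (x : ℕ)) * d.1.1 x = 0 := by omega
      rcases Nat.mul_eq_zero.1 h2 with h3 | h3
      · omega
      · exact h3
  | succ n ih =>
    intro φ h
    rw [Function.iterate_succ_apply]
    refine ih _ fun d hd => ?_
    have hd1 : d ∈ (φ.sum fun c a => a • (if IsStable c.1 then Finsupp.single c (1 : ℝ)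
        else stepAt p q (σ.site c.1) c)).support := by
      simpa [evolve, Finsupp.linearCombination_apply] using hd
    obtain ⟨c, hc, hdc⟩ := Finset.mem_biUnion.1 (Finsupp.support_sum hd1)
    have hdc' := Finsupp.support_smul hdc
    by_cases hs : IsStable c.1
    · rw [if_pos hs] at hdc'
      have : d = c := by simpa using Finsupp.support_single_subset hdc'
      left; rw [this]; exact hs
    · rw [if_neg hs] at hdc'
      have h1 := potential_lt p q _ c (σ.legal c.1 hs) d hdc'
      rcases h c hc with h2 | h2
      · exact absurd h2 hs
      · right; omega

/-- Only stable configurations are left after stabilisation. -/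
theorem stabilise_stable {L : ℕ} (p q : ℝ) (σ : EvolutionRule L) (c : Record L) :
    ∀ d ∈ (stabilise p q σ c).support, IsStable d.1 := by
  refine iterate_stable p q σ _ _ fun d hd => Or.inr ?_
  have : d = c := by simpa using Finsupp.support_single_subset hd
  rw [this]

/-- Any larger number of iterations gives the same result. -/
theorem evolve_iterate_stabilise {L : ℕ} (p q : ℝ) (σ : EvolutionRule L) (c : Record L) (n : ℕ)
    (hn : potential c.1 ≤ n) :
    (evolve p q σ)^[n] (Finsupp.single c 1) = stabilise p q σ c := by
  obtain ⟨k, rfl⟩ := Nat.exists_eq_add_of_le' hn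
  rw [Function.iterate_add_apply]
  exact Function.iterate_fixed (evolve_of_stable p q σ _ (stabilise_stable p q σ c)) k

end

end DSS

/-!
A site which receives `n ≥ 1` particles ends up with a stable particle with probability `p`,
independently of its previous content `z` and of everything else, and sends on `n + z - z'`
particles, where `z'` is its final content; a site which receives nothing does not change. Hence an
avalanche can be realised by independent coins `b` with law `ψ`: the particles are passed from left
to right, and each site which receives some takes the value of its coin (`flow`, `relax`,
`outcome`). The law of the outcome under these coins, as a function of the starting record, is
invariant under each local rule (`linearCombination_law_stepAt`), hence under `evolve` for any
evolution rule, and on stable records it is a point mass. Therefore it is the law of the avalanche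
(`avalanche_eq_law`), and no commutation of topplings at different sites has to be discussed.

Conservation of particles, `s(x) + ∑_{y ≤ x} z'(y) = 1 + ∑_{y ≤ x} z(y)`, identifies `W_x^0` and
`W_x^{≥1}` (`topplings_add_filling`). The state `ψ` is stationary because exchanging coin and
content on each site reached by the avalanche preserves the joint law of the configuration and the
coins (`mean_transition`).

For the two-point function, matrices act on observables, that is on row vectors. Let `x'` be the
left neighbour of `x`, let `d = z(x) - p`, and let `u` and `v` depend on the sites up to `x'` only.
Then `(u d) W = (u W_{x'}^0) d`, since an avalanche with a toppling at `x'` gives `x` a fresh coin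
(`weighted_mul_deviation`), and `s(x) = s(x') + d - d'`, where `d'` is the deviation after the
avalanche (`counted_succ`). As `⟨v d | ψ⟩ = 0` and `⟨v d² | ψ⟩ = p q ⟨v | ψ⟩`, expanding
`⟨s(x,t) s(x,t+τ)⟩` leaves the same quantity at `x'` and, with
`u = ⟨Id| W_{x'}^{≥1} (W_{x'}^0)^{τ-1}`, the term
`p q (⟨u W_{x'}^0 | ψ⟩ - ⟨u | ψ⟩) = - p q ⟨u W_{x'}^{≥1} | ψ⟩` (`mean_counted_succ`).
-/

namespace DSS

/-! ### The coin representation of an avalanche -/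

/-- The number of particles sent on by a site with `z` stable particles which receives `n`
particles in total, if `b` is what it holds at the end. -/
def outflow (n : ℕ) (z b : Bool) : ℕ := if n = 0 then 0 else n + z.toNat - b.toNat

/-- The final content of a site with `z` stable particles which receives `n` particles in total:
the coin `b`, unless nothing arrives. -/
def settled (n : ℕ) (z b : Bool) : Bool := if n = 0 then z else b

variable {L : ℕ}

/-- The number of particles which enter site `k` from the left during the relaxation of `c` with
coins `b`. -/
def flow (c : Config L) (b : Stable L) : ℕ → ℕ
  | 0 => 0
  | k + 1 => if h : k < L then
      outflow (c.1 ⟨k, h⟩ + flow c b k) (c.2 ⟨k, h⟩) (b ⟨k, h⟩) else 0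

/-- The number of particles which `x` has to process during the relaxation of `c` with coins `b`:
those waiting on it, and those coming from the left. -/
def load (c : Config L) (b : Stable L) (x : Fin L) : ℕ := c.1 x + flow c b x

/-- The stable configuration reached from `c` with coins `b`. -/
def relax (c : Config L) (b : Stable L) : Stable L :=
  fun x => settled (load c b x) (c.2 x) (b x)

/-- The number of topplings at each site during the relaxation of `c` with coins `b`. -/
def topplings (c : Config L) (b : Stable L) : Fin L → ℕ := fun x => flow c b (x + 1)

/-- The final state of the record `c` with coins `b`. -/
def outcome (c : Record L) (b : Stable L) : (Fin L → ℕ) × Stable L :=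
  (fun x => c.2 x + topplings c.1 b x, relax c.1 b)

theorem outflow_zero (z b : Bool) : outflow 0 z b = 0 := rfl

theorem outflow_of_pos {n : ℕ} (hn : 0 < n) (z b : Bool) :
    outflow n z b = n + z.toNat - b.toNat := if_neg hn.ne'

theorem settled_zero (z b : Bool) : settled 0 z b = z := rfl

theorem settled_of_pos {n : ℕ} (hn : 0 < n) (z b : Bool) : settled n z b = b := if_neg hn.ne'

theorem addRight_self (x : Fin L) (w : Fin L → ℕ) : addRight x w x = w x := by
  simp [addRight]

theorem removeAt_self (x : Fin L) (w : Fin L → ℕ) : removeAt x w x = w x - 1 := by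
  simp [removeAt]

theorem flow_add_one (c : Config L) (b : Stable L) (k : ℕ) :
    flow c b (k + 1) = if h : k < L then
      outflow (c.1 ⟨k, h⟩ + flow c b k) (c.2 ⟨k, h⟩) (b ⟨k, h⟩) else 0 := rfl

theorem flow_succ (c : Config L) (b : Stable L) (x : Fin L) :
    flow c b (x + 1) = outflow (load c b x) (c.2 x) (b x) := by
  simp [flow, load]

/-- The particles entering site `k` depend only on what happens on the sites before `k`. -/
theorem flow_congr {c c' : Config L} {b b' : Stable L} {k : ℕ}
    (h : ∀ y : Fin L, (y : ℕ) < k → c.1 y = c'.1 y ∧ c.2 y = c'.2 y ∧ b y = b' y) :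
    flow c b k = flow c' b' k := by
  induction k with
  | zero => rfl
  | succ k ih =>
    simp only [flow]
    split_ifs with hk
    · obtain ⟨h1, h2, h3⟩ := h ⟨k, hk⟩ (Nat.lt_succ_self k)
      rw [h1, h2, h3, ih fun y hy => h y (hy.trans (Nat.lt_succ_self k))]
    · rfl

/-- A change at `x` which moves `e` particles to the next site, and records these topplings, does
not affect the outcome as soon as the final content of `x` is the same and its remaining outflow
is lower by `e`. -/
theorem outcome_congr {c c' : Record L} {b b' : Stable L} {x : Fin L} {e : ℕ}
    (hz : ∀ y, y ≠ x → c'.1.2 y = c.1.2 y) (hb : ∀ y, y ≠ x → b' y = b y)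
    (hw : ∀ y, y ≠ x → c'.1.1 y = c.1.1 y + if (y : ℕ) = x + 1 then e else 0)
    (hs : ∀ y, c'.2 y = c.2 y + if y = x then e else 0)
    (hout : outflow (load c.1 b x) (c.1.2 x) (b x)
      = outflow (c'.1.1 x + flow c.1 b x) (c'.1.2 x) (b' x) + e)
    (hset : settled (c'.1.1 x + flow c.1 b x) (c'.1.2 x) (b' x)
      = settled (load c.1 b x) (c.1.2 x) (b x)) :
    outcome c' b' = outcome c b := by
  have hle : ∀ k ≤ (x : ℕ), flow c'.1 b' k = flow c.1 b k := fun k hk =>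
    flow_congr fun y hy => by
      have hyx : y ≠ x := fun h => by rw [h] at hy; omega
      refine ⟨?_, hz y hyx, hb y hyx⟩
      rw [hw y hyx, if_neg (by omega), add_zero]
  have hx : flow c.1 b (x + 1) = flow c'.1 b' (x + 1) + e := by
    rw [flow_succ, flow_succ, hout, load, hle x le_rfl]
  have hgt : ∀ k, (x : ℕ) + 2 ≤ k → flow c'.1 b' k = flow c.1 b k := by
    intro k hk
    induction k, hk using Nat.le_induction with
    | base =>
      rw [flow_add_one c'.1 b' (x + 1), flow_add_one c.1 b (x + 1)]
      split_ifs with h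
      · have hne : (⟨x + 1, h⟩ : Fin L) ≠ x := fun h' => by simpa using congrArg Fin.val h'
        rw [hz _ hne, hb _ hne, hw _ hne, if_pos rfl, hx]
        congr 1
        ring
      · rfl
    | succ k hk ih =>
      rw [flow, flow]
      split_ifs with h
      · have hne : (⟨k, h⟩ : Fin L) ≠ x := fun h' => by
          have := congrArg Fin.val h'
          simp only at this
          omega
        rw [hz _ hne, hb _ hne, hw _ hne, if_neg (by simp only; omega), ih, add_zero]
      · rfl
  refine Prod.ext (funext fun y => ?_) (funext fun y => ?_)
  · simp only [outcome, topplings, hs y]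
    by_cases hy : y = x
    · subst hy
      rw [if_pos rfl, hx]
      ring
    · have hy' : (y : ℕ) ≠ x := fun h => hy (Fin.ext h)
      rw [if_neg hy, add_zero]
      congr 1
      rcases lt_or_gt_of_ne hy' with h | h
      · exact hle _ h
      · exact hgt _ (by omega)
  · simp only [outcome, relax]
    by_cases hy : y = x
    · subst hy
      rw [load, hle _ le_rfl, hset]
    · have hy' : (y : ℕ) ≠ x := fun h => hy (Fin.ext h)
      have hload : load c'.1 b' y = load c.1 b y := by
        rw [load, load, hw y hy]
        rcases lt_trichotomy (y : ℕ) (x + 1) with h | h | h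
        · rw [if_neg (by omega), hle _ (by omega), add_zero]
        · rw [if_pos h, h, hx]
          ring
        · rw [if_neg (by omega), hgt _ (by omega), add_zero]
      rw [hload, hz y hy, hb y hy]

theorem flow_of_isStable {c : Config L} (hc : IsStable c) (b : Stable L) (k : ℕ) :
    flow c b k = 0 := by
  induction k with
  | zero => rfl
  | succ k ih =>
    rw [flow]
    split_ifs with h
    · simp [ih, hc ⟨k, h⟩, outflow]
    · rfl

theorem outcome_of_isStable {c : Record L} (hc : IsStable c.1) (b : Stable L) :
    outcome c b = (c.2, c.1.2) := by
  refine Prod.ext (funext fun x => ?_) (funext fun x => ?_)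
  · simp [outcome, topplings, flow_of_isStable hc]
  · simp [outcome, relax, settled, load, flow_of_isStable hc, hc x]

/-! ### Averages over independent coins -/

variable {p q : ℝ}

theorem sum_psi (hpq : p + q = 1) : ∑ b : Stable L, psi p q b = 1 := by
  have h := Finset.prod_univ_sum (fun _ : Fin L => (Finset.univ : Finset Bool))
    (fun _ b => if b = true then p else q)
  simp only [Fintype.sum_bool, Fintype.piFinset_univ, if_true, Bool.false_eq_true, if_false, hpq,
    Finset.prod_const_one] at h
  exact h.symm

theorem psi_update (b : Stable L) (x : Fin L) (v : Bool) :
    psi p q (Function.update b x v)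
      = (if v = true then p else q) * ∏ y ∈ Finset.univ.erase x, if b y = true then p else q := by
  rw [psi, ← Finset.mul_prod_erase _ _ (Finset.mem_univ x), Function.update_self]
  congr 1
  exact Finset.prod_congr rfl fun y hy => by
    rw [Function.update_of_ne (Finset.ne_of_mem_erase hy)]

/-- Averaging first over the coin at `x`. -/
theorem sum_psi_update {M : Type*} [AddCommGroup M] [Module ℝ M] (hpq : p + q = 1) (x : Fin L)
    (f : Stable L → M) :
    ∑ b, psi p q b • f b
      = ∑ b, psi p q b • (p • f (Function.update b x true)
          + q • f (Function.update b x false)) := by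
  -- Both sides are unchanged when each summand is replaced by its mean over the flip at `x`.
  have hflip : ∀ g : Stable L → M, (2 : ℝ) • ∑ b, psi p q b • g b
      = ∑ b, ((∏ y ∈ Finset.univ.erase x, if b y = true then p else q) •
          (p • g (Function.update b x true) + q • g (Function.update b x false))) := by
    intro g
    have hinv : Function.Involutive fun b : Stable L => Function.update b x (!(b x)) := by
      intro b
      simp
    have hsum := Equiv.sum_comp hinv.toPerm fun b => psi p q b • g b
    rw [two_smul]
    nth_rewrite 2 [← hsum]
    rw [← Finset.sum_add_distrib]
    refine Finset.sum_congr rfl fun b _ => ?_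
    rw [Function.Involutive.coe_toPerm]
    have hb : psi p q b • g b
        = psi p q (Function.update b x (b x)) • g (Function.update b x (b x)) := by
      rw [Function.update_eq_self]
    rw [hb, psi_update, psi_update]
    cases b x
    · simp only [Bool.not_false, Bool.false_eq_true, if_true, if_false]
      module
    · simp only [Bool.not_true, Bool.false_eq_true, if_true, if_false]
      module
  have h2 : (2 : ℝ) ≠ 0 := two_ne_zero
  refine smul_right_injective M h2 ?_
  simp only
  rw [hflip, hflip]
  refine Finset.sum_congr rfl fun b _ => ?_
  simp only [Function.update_idem]
  rw [← add_smul, hpq, one_smul]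

/-! ### The law of an avalanche -/

/-- The law of the final state of the record `c` when the coins are independent, with
distribution `ψ`. -/
noncomputable def law (p q : ℝ) (c : Record L) : ((Fin L → ℕ) × Stable L) →₀ ℝ :=
  ∑ b : Stable L, psi p q b • Finsupp.single (outcome c b) 1

/-- The law of the outcome is not changed by the evolution of any one waiting particle. If `x` holds
a stable particle, or has at least two particles to process, then `x` still awaits its coin after
the step, and the outcome is the same for the same coins. Otherwise the local rule at `x` is the
toss of its coin. -/
theorem linearCombination_law_stepAt (hpq : p + q = 1) (x : Fin L) (c : Record L)
    (hx : 0 < c.1.1 x) :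
    Finsupp.linearCombination ℝ (law p q) (stepAt p q x c) = law p q c := by
  obtain ⟨⟨w, z⟩, s⟩ := c
  simp only at hx
  by_cases hz : z x = true
  · simp only [stepAt, hz, if_true, Finsupp.linearCombination_single, one_smul, law]
    refine Finset.sum_congr rfl fun b _ => ?_
    have hpos : 0 < w x + flow (w, z) b x := by omega
    rw [outcome_congr (c := ((w, z), s)) (b := b) (b' := b) (x := x) (e := 1)]
    · intro y hy
      simp [hy]
    · simp
    · intro y hy
      simp only [addRight]
      split_ifs <;> rfl
    · intro y
      by_cases hy : y = x
      · subst hy; simp [countAt]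
      · simp [countAt, hy]
    · have : (b x).toNat ≤ 1 := Bool.toNat_le _
      simp only [load, addRight_self, Function.update_self, hz]
      rw [outflow_of_pos hpos, outflow_of_pos hpos, Bool.toNat_false, Bool.toNat_true]
      omega
    · simp only [load, addRight_self]
      rw [settled_of_pos hpos, settled_of_pos hpos]
  · have hz' : z x = false := by simpa using hz
    rw [stepAt, if_neg hz, map_add, Finsupp.linearCombination_single,
      Finsupp.linearCombination_single, law, law, law]
    rw [sum_psi_update hpq x (fun b => Finsupp.single
      (outcome ((removeAt x w, Function.update z x true), s) b) (1 : ℝ)),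
      sum_psi_update hpq x (fun b => Finsupp.single
      (outcome ((addRight x (removeAt x w), z), countAt x s) b) (1 : ℝ)),
      sum_psi_update hpq x (fun b => Finsupp.single (outcome ((w, z), s) b) (1 : ℝ)),
      Finset.smul_sum, Finset.smul_sum, ← Finset.sum_add_distrib]
    refine Finset.sum_congr rfl fun b _ => ?_
    have hflow : ∀ v, flow (w, z) (Function.update b x v) x = flow (w, z) b x := fun v =>
      flow_congr fun y hy => ⟨rfl, rfl, Function.update_of_ne (fun h => by
        rw [h] at hy; omega) _ _⟩
    -- the particle settles at once
    have hsettle : ∀ u v : Bool, (w x + flow (w, z) b x = 1 → v = true) →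
        (w x + flow (w, z) b x ≠ 1 → v = u) →
        outcome ((removeAt x w, Function.update z x true), s) (Function.update b x u)
          = outcome ((w, z), s) (Function.update b x v) := by
      intro u v h1 h2
      apply outcome_congr (x := x) (e := 0)
      · intro y hy
        simp [hy]
      · intro y hy
        simp [hy]
      · intro y hy
        simp [removeAt, hy]
      · simp
      · simp only [hflow, load, removeAt_self, Function.update_self, hz']
        by_cases h : w x + flow (w, z) b x = 1
        · rw [h1 h, h, show w x - 1 + flow (w, z) b x = 0 by omega]
          rfl
        · rw [h2 h, outflow_of_pos (by omega), outflow_of_pos (by omega), Bool.toNat_false,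
            Bool.toNat_true]
          omega
      · simp only [hflow, load, removeAt_self, Function.update_self]
        by_cases h : w x + flow (w, z) b x = 1
        · rw [h1 h, h, show w x - 1 + flow (w, z) b x = 0 by omega]
          rfl
        · rw [h2 h, settled_of_pos (by omega), settled_of_pos (by omega)]
    -- the particle is transferred to the right
    have htransfer : ∀ u v : Bool, (w x + flow (w, z) b x = 1 → v = false) →
        (w x + flow (w, z) b x ≠ 1 → v = u) →
        outcome ((addRight x (removeAt x w), z), countAt x s) (Function.update b x u)
          = outcome ((w, z), s) (Function.update b x v) := by
      intro u v h1 h2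
      apply outcome_congr (x := x) (e := 1)
      · simp
      · intro y hy
        simp [hy]
      · intro y hy
        simp only [addRight, removeAt, Function.update_of_ne hy]
        split_ifs <;> rfl
      · intro y
        by_cases hy : y = x
        · subst hy; simp [countAt]
        · simp [countAt, hy]
      · have : u.toNat ≤ 1 := Bool.toNat_le _
        simp only [hflow, load, addRight_self, removeAt_self, Function.update_self, hz']
        by_cases h : w x + flow (w, z) b x = 1
        · rw [h1 h, h, show w x - 1 + flow (w, z) b x = 0 by omega]
          rfl
        · rw [h2 h, outflow_of_pos (by omega), outflow_of_pos (by omega), Bool.toNat_false]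
          omega
      · simp only [hflow, load, addRight_self, removeAt_self, Function.update_self]
        by_cases h : w x + flow (w, z) b x = 1
        · rw [h1 h, h, show w x - 1 + flow (w, z) b x = 0 by omega, settled_zero,
            settled_of_pos one_pos, hz']
        · rw [h2 h, settled_of_pos (by omega), settled_of_pos (by omega)]
    by_cases h : w x + flow (w, z) b x = 1
    · rw [hsettle true true (fun _ => rfl) (fun h' => absurd h h'),
        hsettle false true (fun _ => rfl) (fun h' => absurd h h'),
        htransfer true false (fun _ => rfl) (fun h' => absurd h h'),
        htransfer false false (fun _ => rfl) (fun h' => absurd h h'),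
        ← add_smul, ← add_smul, hpq, one_smul, one_smul, smul_comm p, smul_comm q, smul_add]
    · rw [hsettle true true (fun h' => absurd h' h) (fun _ => rfl),
        hsettle false false (fun h' => absurd h' h) (fun _ => rfl),
        htransfer true true (fun h' => absurd h' h) (fun _ => rfl),
        htransfer false false (fun h' => absurd h' h) (fun _ => rfl),
        ← add_smul, hpq, one_smul]

theorem law_of_isStable (hpq : p + q = 1) {c : Record L} (hc : IsStable c.1) :
    law p q c = Finsupp.single (c.2, c.1.2) 1 := by
  simp only [law, outcome_of_isStable hc]
  rw [← Finset.sum_smul, sum_psi hpq, one_smul]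

theorem linearCombination_law_evolve (hpq : p + q = 1) (σ : EvolutionRule L)
    (φ : Record L →₀ ℝ) :
    Finsupp.linearCombination ℝ (law p q) (evolve p q σ φ)
      = Finsupp.linearCombination ℝ (law p q) φ := by
  induction φ using Finsupp.induction_linear with
  | zero => simp
  | add f g hf hg => simp [hf, hg]
  | single c a =>
    by_cases hc : IsStable c.1
    · rw [evolve_single_of_stable p q σ c hc]
    · simp only [evolve, Finsupp.linearCombination_single, if_neg hc, map_smul]
      rw [linearCombination_law_stepAt hpq _ c (σ.legal c.1 hc)]

/-- Independently of the evolution rule, the avalanche has the law given by the coins. -/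
theorem avalanche_eq_law (hpq : p + q = 1) (σ : EvolutionRule L) (r : Stable L) :
    avalanche p q σ r = law p q (inject r) := by
  have h1 : Finsupp.linearCombination ℝ (law p q) (stabilise p q σ (inject r))
      = law p q (inject r) := by
    rw [stabilise]
    generalize potential (inject r).1 = n
    induction n with
    | zero => simp
    | succ n ih => rw [Function.iterate_succ_apply', linearCombination_law_evolve hpq, ih]
  rw [← h1, avalanche, Finsupp.mapDomain, Finsupp.linearCombination_apply]
  refine Finset.sum_congr rfl fun d hd => ?_
  simp only
  rw [law_of_isStable hpq (stabilise_stable p q σ _ d hd), Finsupp.smul_single, smul_eq_mul,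
    mul_one]

/-- Averages over an avalanche are averages over the coins. -/
theorem linearCombination_avalanche {M : Type*} [AddCommGroup M] [Module ℝ M] (hpq : p + q = 1)
    (σ : EvolutionRule L) (r : Stable L) (F : (Fin L → ℕ) × Stable L → M) :
    Finsupp.linearCombination ℝ F (avalanche p q σ r)
      = ∑ b, psi p q b • F (topplings (inject r).1 b, relax (inject r).1 b) := by
  rw [avalanche_eq_law hpq, law, map_sum]
  refine Finset.sum_congr rfl fun b _ => ?_
  rw [map_smul, Finsupp.linearCombination_single, one_smul]
  have : outcome (inject r) b = (topplings (inject r).1 b, relax (inject r).1 b) :=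
    Prod.ext (funext fun x => Nat.zero_add _) rfl
  rw [this]

open Classical in
theorem avalancheProb_eq (hpq : p + q = 1) (σ : EvolutionRule L) (r r' : Stable L)
    (A : (Fin L → ℕ) → Prop) :
    avalancheProb p q σ r r' A = ∑ b, psi p q b *
      if A (topplings (inject r).1 b) ∧ relax (inject r).1 b = r' then 1 else 0 := by
  have h := linearCombination_avalanche hpq σ r fun k =>
    if A k.1 ∧ k.2 = r' then (1 : ℝ) else 0
  simp only [smul_eq_mul] at h
  rw [← h, avalancheProb, Finsupp.linearCombination_apply]
  refine Finset.sum_congr rfl fun k _ => ?_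
  simp

/-! ### Conservation of particles -/

theorem outflow_add_settled (n : ℕ) (z b : Bool) :
    outflow n z b + (settled n z b).toNat = n + z.toNat := by
  rcases Nat.eq_zero_or_pos n with rfl | hn
  · rw [outflow_zero, settled_zero]
  · have : b.toNat ≤ 1 := Bool.toNat_le _
    rw [outflow_of_pos hn, settled_of_pos hn]
    omega

theorem topplings_add_relax (c : Config L) (b : Stable L) (x : Fin L) :
    topplings c b x + (relax c b x).toNat = load c b x + (c.2 x).toNat := by
  rw [topplings, flow_succ, relax, outflow_add_settled]

/-- On the sites after the first one, only the topplings of the left neighbour bring particles. -/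
theorem load_inject (r b : Stable L) {x x' : Fin L} (h : (x : ℕ) = x' + 1) :
    load (inject r).1 b x = topplings (inject r).1 b x' := by
  simp [load, topplings, inject, h]

theorem filling_succ (r : Stable L) {x x' : Fin L} (h : (x : ℕ) = x' + 1) :
    filling x r = filling x' r + (r x).toNat := by
  have : Finset.Iic x = insert x (Finset.Iic x') := by
    ext y
    simp only [Finset.mem_Iic, Finset.mem_insert, Fin.le_def, Fin.ext_iff]
    omega
  rw [filling, this, Finset.sum_insert, filling, add_comm]
  simp only [Finset.mem_Iic, Fin.le_def]
  omega

/-- The topplings at `x` are the particles which leave the sites up to `x`. -/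
theorem topplings_add_filling (r b : Stable L) (x : Fin L) :
    topplings (inject r).1 b x + filling x (relax (inject r).1 b) = 1 + filling x r := by
  obtain ⟨k, hk⟩ := x
  induction k with
  | zero =>
    have hI : Finset.Iic (⟨0, hk⟩ : Fin L) = {⟨0, hk⟩} := by
      ext y
      simp only [Finset.mem_Iic, Finset.mem_singleton, Fin.le_def, Fin.ext_iff]
      omega
    have h := topplings_add_relax (inject r).1 b ⟨0, hk⟩
    have h1 : load (inject r).1 b ⟨0, hk⟩ = 1 := by simp [load, inject, flow]
    have hr : (inject r).1.2 = r := rfl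
    rw [h1, hr] at h
    simpa [filling, hI] using h
  | succ k ih =>
    have h := topplings_add_relax (inject r).1 b ⟨k + 1, hk⟩
    rw [load_inject r b (x' := ⟨k, by omega⟩) rfl] at h
    rw [filling_succ (x := ⟨k + 1, hk⟩) (x' := ⟨k, by omega⟩) _ rfl,
      filling_succ (x := ⟨k + 1, hk⟩) (x' := ⟨k, by omega⟩) _ rfl]
    have := ih (by omega)
    have hr : (inject r).1.2 = r := rfl
    rw [hr] at h
    omega

theorem WZero_apply (hpq : p + q = 1) (σ : EvolutionRule L) (y : Fin L) (r r' : Stable L) :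
    WZero p q σ y r' r = avalancheProb p q σ r r' fun s => s y = 0 := by
  classical
  rw [WZero, W, Matrix.of_apply, Matrix.of_apply, avalancheProb_eq hpq, avalancheProb_eq hpq,
    Finset.mul_sum]
  refine Finset.sum_congr rfl fun b _ => ?_
  have h := topplings_add_filling r b y
  by_cases hr : relax (inject r).1 b = r'
  · rw [hr] at h
    by_cases h0 : topplings (inject r).1 b y = 0
    · simp [hr, h0, show 1 + filling y r = filling y r' by omega]
    · simp [hr, h0, show ¬ (1 + filling y r = filling y r') by omega]
  · simp [hr]

theorem WPos_apply (hpq : p + q = 1) (σ : EvolutionRule L) (y : Fin L) (r r' : Stable L) :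
    WPos p q σ y r' r = avalancheProb p q σ r r' fun s => 1 ≤ s y := by
  classical
  rw [WPos, W, Matrix.of_apply, Matrix.of_apply, avalancheProb_eq hpq, avalancheProb_eq hpq,
    Finset.mul_sum]
  refine Finset.sum_congr rfl fun b _ => ?_
  have h := topplings_add_filling r b y
  by_cases hr : relax (inject r).1 b = r'
  · rw [hr] at h
    by_cases h0 : topplings (inject r).1 b y = 0
    · simp [hr, h0, show 1 + filling y r = filling y r' by omega]
    · simp [hr, Nat.one_le_iff_ne_zero, h0, show ¬ (1 + filling y r = filling y r') by omega]
  · simp [hr]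

/-! ### Operators on observables -/

/-- The mean of an observable in the state `ψ`. -/
noncomputable def mean (p q : ℝ) : (Stable L → ℝ) →ₗ[ℝ] ℝ where
  toFun u := ∑ r, psi p q r * u r
  map_add' u v := by simp [mul_add, Finset.sum_add_distrib]
  map_smul' a u := by
    simp only [Pi.smul_apply, smul_eq_mul, RingHom.id_apply, Finset.mul_sum]
    exact Finset.sum_congr rfl fun r _ => by ring

/-- The operator which sends the observable `u` to the mean of `κ (s(x)) * u(r')` over the avalanche
from `r` to `r'`, as a function of `r`. It acts on the row vector `u` as a weighted version of `W`
does by multiplication from the right. -/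
noncomputable def weighted (p q : ℝ) (x : Fin L) (κ : ℕ → ℝ) :
    (Stable L → ℝ) →ₗ[ℝ] (Stable L → ℝ) where
  toFun u r := ∑ b, psi p q b * (κ (topplings (inject r).1 b x) * u (relax (inject r).1 b))
  map_add' u v := by
    funext r
    simp [mul_add, Finset.sum_add_distrib]
  map_smul' a u := by
    funext r
    simp only [Pi.smul_apply, smul_eq_mul, RingHom.id_apply, Finset.mul_sum]
    exact Finset.sum_congr rfl fun r _ => by ring

theorem mean_apply (u : Stable L → ℝ) : mean p q u = ∑ r, psi p q r * u r := rfl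

theorem weighted_apply (x : Fin L) (κ : ℕ → ℝ) (u : Stable L → ℝ) (r : Stable L) :
    weighted p q x κ u r
      = ∑ b, psi p q b * (κ (topplings (inject r).1 b x) * u (relax (inject r).1 b)) := rfl

/-- The transition operator: the mean of an observable after an avalanche. -/
noncomputable abbrev transition (p q : ℝ) (x : Fin L) := weighted p q x fun _ => 1

/-- The part of the transition operator without toppling at `x`. -/
noncomputable abbrev quiet (p q : ℝ) (x : Fin L) := weighted p q x fun n => if n = 0 then 1 else 0

/-- The part of the transition operator with a toppling at `x`. -/
noncomputable abbrev active (p q : ℝ) (x : Fin L) := weighted p q x fun n => if 1 ≤ n then 1 else 0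

/-- The transition operator weighted by the number of topplings at `x`. -/
noncomputable abbrev counted (p q : ℝ) (x : Fin L) := weighted p q x fun n => (n : ℝ)

theorem transition_eq_quiet_add_active (x : Fin L) (u : Stable L → ℝ) :
    transition p q x u = quiet p q x u + active p q x u := by
  funext r
  rw [Pi.add_apply, weighted_apply, weighted_apply, weighted_apply, ← Finset.sum_add_distrib]
  refine Finset.sum_congr rfl fun b _ => ?_
  by_cases h : topplings (inject r).1 b x = 0
  · simp [h]
  · simp [h, Nat.one_le_iff_ne_zero]

theorem transition_one (hpq : p + q = 1) (x : Fin L) : transition p q x 1 = 1 := by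
  funext r
  simp [weighted_apply, sum_psi hpq]

/-- A matrix of avalanche probabilities, restricted by the number of topplings at `x`, acts on row
vectors as the corresponding weighted operator. -/
theorem vecMul_avalancheProb (hpq : p + q = 1) (σ : EvolutionRule L) (x : Fin L) (A : ℕ → Prop)
    [DecidablePred A] (u : Stable L → ℝ) (M : Matrix (Stable L) (Stable L) ℝ)
    (hM : ∀ r r', M r' r = avalancheProb p q σ r r' fun s => A (s x)) :
    Matrix.vecMul u M = weighted p q x (fun n => if A n then 1 else 0) u := by
  classical
  funext r
  simp only [Matrix.vecMul, dotProduct, hM, avalancheProb_eq hpq, weighted_apply, Finset.mul_sum]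
  rw [Finset.sum_comm]
  refine Finset.sum_congr rfl fun b _ => ?_
  rw [Finset.sum_eq_single (relax (inject r).1 b)]
  · by_cases h : A (topplings (inject r).1 b x) <;> simp [h, mul_comm]
  · intro r' _ hr'
    simp [hr'.symm]
  · simp

theorem vecMul_WZero (hpq : p + q = 1) (σ : EvolutionRule L) (x : Fin L) (u : Stable L → ℝ) :
    Matrix.vecMul u (WZero p q σ x) = quiet p q x u :=
  vecMul_avalancheProb hpq σ x (fun n => n = 0) u _ fun r r' => WZero_apply hpq σ x r r'

theorem vecMul_WPos (hpq : p + q = 1) (σ : EvolutionRule L) (x : Fin L) (u : Stable L → ℝ) :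
    Matrix.vecMul u (WPos p q σ x) = active p q x u :=
  vecMul_avalancheProb hpq σ x (fun n => 1 ≤ n) u _ fun r r' => WPos_apply hpq σ x r r'

theorem vecMul_WZero_pow (hpq : p + q = 1) (σ : EvolutionRule L) (x : Fin L) (k : ℕ)
    (u : Stable L → ℝ) :
    Matrix.vecMul u (WZero p q σ x ^ k) = (quiet p q x ^ k) u := by
  induction k with
  | zero => simp
  | succ k ih =>
    rw [pow_succ, ← Matrix.vecMul_vecMul, ih, vecMul_WZero hpq, pow_succ', Module.End.mul_apply]

theorem braId_eq_mean (hpq : p + q = 1) (σ : EvolutionRule L) (x : Fin L) (k : ℕ) :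
    braId ((WPos p q σ x * WZero p q σ x ^ k * WPos p q σ x).mulVec (psi p q))
      = mean p q (active p q x ((quiet p q x ^ k) (active p q x 1))) := by
  have h : ∀ v : Stable L → ℝ, braId v = dotProduct 1 v := fun v => by
    simp [braId, dotProduct]
  rw [h, Matrix.dotProduct_mulVec, ← Matrix.vecMul_vecMul, ← Matrix.vecMul_vecMul,
    vecMul_WPos hpq, vecMul_WZero_pow hpq, vecMul_WPos hpq, dotProduct_comm]
  rfl

/-! ### Stationarity -/

/-- Relaxation exchanges, on each site which processes particles, the coin and the stable
particles. -/
def exchange (w : Fin L → ℕ) (a : Stable L × Stable L) : Stable L × Stable L :=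
  (relax (w, a.1) a.2, fun x => settled (load (w, a.1) a.2 x) (a.2 x) (a.1 x))

theorem exchange_injective (w : Fin L → ℕ) : Function.Injective (exchange w) := by
  rintro ⟨r, b⟩ ⟨r', b'⟩ h
  have hk : ∀ k : ℕ, ∀ y : Fin L, (y : ℕ) < k → r y = r' y ∧ b y = b' y := by
    intro k
    induction k with
    | zero => intro y hy; omega
    | succ k ih =>
      intro y hy
      have hload : load (w, r) b y = load (w, r') b' y := by
        rw [load, load, flow_congr (c := (w, r)) (c' := (w, r')) (b := b) (b' := b')]
        intro z hz
        have := ih z (by omega)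
        exact ⟨rfl, this.1, this.2⟩
      have h1 := congrFun (congrArg Prod.fst h) y
      have h2 := congrFun (congrArg Prod.snd h) y
      simp only [exchange, relax, hload] at h1 h2
      rcases Nat.eq_zero_or_pos (load (w, r') b' y) with h0 | h0
      · rw [h0] at h1 h2
        exact ⟨h1, h2⟩
      · rw [settled_of_pos h0, settled_of_pos h0] at h1 h2
        exact ⟨h2, h1⟩
  exact Prod.ext (funext fun y => (hk L y y.2).1) (funext fun y => (hk L y y.2).2)

theorem psi_mul_psi_exchange (w : Fin L → ℕ) (a : Stable L × Stable L) :
    psi p q (exchange w a).1 * psi p q (exchange w a).2 = psi p q a.1 * psi p q a.2 := by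
  simp only [psi, ← Finset.prod_mul_distrib]
  refine Finset.prod_congr rfl fun x _ => ?_
  have h : (exchange w a).1 x = a.1 x ∧ (exchange w a).2 x = a.2 x ∨
      (exchange w a).1 x = a.2 x ∧ (exchange w a).2 x = a.1 x := by
    simp only [exchange, relax]
    rcases Nat.eq_zero_or_pos (load (w, a.1) a.2 x) with h0 | h0
    · exact Or.inl (by simp [h0, settled_zero])
    · exact Or.inr (by simp [settled_of_pos h0])
  rcases h with ⟨h1, h2⟩ | ⟨h1, h2⟩
  · rw [h1, h2]
  · rw [h1, h2, mul_comm]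

/-- `ψ` is stationary: the exchange of the configuration with the coins preserves their
joint law. -/
theorem mean_transition (hpq : p + q = 1) (x : Fin L) (u : Stable L → ℝ) :
    mean p q (transition p q x u) = mean p q u := by
  have hbij := Finite.injective_iff_bijective.1
    (exchange_injective fun y : Fin L => if (y : ℕ) = 0 then 1 else 0)
  calc mean p q (transition p q x u)
      = ∑ a : Stable L × Stable L, psi p q a.1 * psi p q a.2
          * u (relax (inject a.1).1 a.2) := by
        rw [Fintype.sum_prod_type]
        simp only [mean_apply, weighted_apply, Finset.mul_sum]
        exact Finset.sum_congr rfl fun r _ => Finset.sum_congr rfl fun b _ => by ring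
    _ = ∑ a : Stable L × Stable L, psi p q a.1 * psi p q a.2 * u a.1 := by
        rw [← hbij.sum_comp fun a => psi p q a.1 * psi p q a.2 * u a.1]
        exact Finset.sum_congr rfl fun a _ => by rw [psi_mul_psi_exchange]; rfl
    _ = mean p q u := by
        rw [Fintype.sum_prod_type, mean_apply]
        refine Finset.sum_congr rfl fun r _ => ?_
        simp only
        rw [← Finset.sum_mul, ← Finset.mul_sum, sum_psi hpq, mul_one]

/-! ### The two-point function as a matrix element -/

theorem linearCombination_trajectory_succ (hpq : p + q = 1) (σ : EvolutionRule L) (n : ℕ)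
    (F : (ℕ → Fin L → ℕ) × Stable L → ℝ) :
    Finsupp.linearCombination ℝ F (trajectory p q σ (n + 1))
      = Finsupp.linearCombination ℝ (fun h => ∑ b, psi p q b *
          F (Function.update h.1 n (topplings (inject h.2).1 b), relax (inject h.2).1 b))
          (trajectory p q σ n) := by
  rw [trajectory, Finsupp.linearCombination_linearCombination]
  congr 2
  funext h
  rw [Finsupp.linearCombination_mapDomain, linearCombination_avalanche hpq]
  rfl

/-- The configuration after any number of avalanches has law `ψ`. -/
theorem linearCombination_trajectory_snd (hpq : p + q = 1) (σ : EvolutionRule L) (x : Fin L)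
    (n : ℕ) (u : Stable L → ℝ) :
    Finsupp.linearCombination ℝ (fun h => u h.2) (trajectory p q σ n) = mean p q u := by
  induction n generalizing u with
  | zero => simp [trajectory, mean_apply]
  | succ n ih =>
    rw [linearCombination_trajectory_succ hpq, ← mean_transition hpq x u, ← ih]
    simp [weighted_apply]

/-- Until the next observation, only the transition operator acts. -/
theorem linearCombination_trajectory_add (hpq : p + q = 1) (σ : EvolutionRule L) (x : Fin L)
    (t k : ℕ) (u : Stable L → ℝ) :
    Finsupp.linearCombination ℝ (fun h => (h.1 t x : ℝ) * u h.2) (trajectory p q σ (t + 1 + k))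
      = Finsupp.linearCombination ℝ (fun h => (h.1 t x : ℝ) * (transition p q x ^ k) u h.2)
          (trajectory p q σ (t + 1)) := by
  induction k generalizing u with
  | zero => simp
  | succ k ih =>
    rw [← add_assoc, linearCombination_trajectory_succ hpq, pow_succ, Module.End.mul_apply, ← ih]
    congr 2
    funext h
    have hne : t ≠ t + 1 + k := by omega
    simp only [Function.update_of_ne hne, weighted_apply, Finset.mul_sum]
    exact Finset.sum_congr rfl fun b _ => by ring

theorem corr_eq_mean (hpq : p + q = 1) (σ : EvolutionRule L) (x : Fin L) (t k : ℕ) :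
    corr p q σ x t (k + 1)
      = mean p q (counted p q x ((transition p q x ^ k) (counted p q x 1))) := by
  have h1 : corr p q σ x t (k + 1) = Finsupp.linearCombination ℝ
      (fun h => (h.1 t x : ℝ) * (h.1 (t + 1 + k) x : ℝ)) (trajectory p q σ (t + 1 + k + 1)) := by
    rw [corr, Finsupp.linearCombination_apply, show t + (k + 1) = t + 1 + k by ring]
    rfl
  have h2 : (fun h : (ℕ → Fin L → ℕ) × Stable L => ∑ b, psi p q b *
      ((Function.update h.1 (t + 1 + k) (topplings (inject h.2).1 b) t x : ℝ) *
        (Function.update h.1 (t + 1 + k) (topplings (inject h.2).1 b) (t + 1 + k) x : ℝ)))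
      = fun h => (h.1 t x : ℝ) * counted p q x 1 h.2 := by
    funext h
    have hne : t ≠ t + 1 + k := by omega
    simp only [Function.update_of_ne hne, Function.update_self, weighted_apply, Finset.mul_sum]
    exact Finset.sum_congr rfl fun b _ => by simp only [Pi.one_apply]; ring
  rw [h1, linearCombination_trajectory_succ hpq, h2, linearCombination_trajectory_add hpq,
    linearCombination_trajectory_succ hpq, ← linearCombination_trajectory_snd hpq σ x t]
  congr 2
  funext h
  simp [weighted_apply]

/-! ### The fluctuation of one site -/

/-- The deviation of the number of stable particles on `x` from its mean. -/
def deviation (p : ℝ) (x : Fin L) : Stable L → ℝ := fun r => ((r x).toNat : ℝ) - p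

theorem topplings_congr {r r' b b' : Stable L} {x : Fin L}
    (hr : ∀ y ∈ Set.Iic x, r y = r' y) (hb : ∀ y ∈ Set.Iic x, b y = b' y) :
    topplings (inject r).1 b x = topplings (inject r').1 b' x :=
  flow_congr fun y hy =>
    have hyx : y ∈ Set.Iic x := Fin.le_def.2 (by omega)
    ⟨rfl, hr y hyx, hb y hyx⟩

theorem relax_congr {r r' b b' : Stable L} {x : Fin L}
    (hr : ∀ y ∈ Set.Iic x, r y = r' y) (hb : ∀ y ∈ Set.Iic x, b y = b' y) :
    ∀ y ∈ Set.Iic x, relax (inject r).1 b y = relax (inject r').1 b' y := by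
  intro y hy
  have hyx : (y : ℕ) ≤ x := Fin.le_def.1 hy
  have hflow : flow (inject r).1 b y = flow (inject r').1 b' y := flow_congr fun z hz =>
    have hzx : z ∈ Set.Iic x := Fin.le_def.2 (by omega)
    ⟨rfl, hr z hzx, hb z hzx⟩
  have h1 : (inject r).1.2 y = (inject r').1.2 y := hr y hy
  have h2 : (inject r).1.1 y = (inject r').1.1 y := rfl
  rw [relax, relax, load, load, hflow, h1, h2, hb y hy]

/-- Particles only move to the right: the sites up to `x` evolve on their own. -/
theorem dependsOn_weighted {x : Fin L} {u : Stable L → ℝ} (hu : DependsOn u (Set.Iic x))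
    (κ : ℕ → ℝ) : DependsOn (weighted p q x κ u) (Set.Iic x) := by
  intro r r' hr
  rw [weighted_apply, weighted_apply]
  refine Finset.sum_congr rfl fun b _ => ?_
  rw [topplings_congr hr fun _ _ => rfl, hu (relax_congr hr fun _ _ => rfl)]

theorem dependsOn_weighted_pow {x : Fin L} {u : Stable L → ℝ} (hu : DependsOn u (Set.Iic x))
    (κ : ℕ → ℝ) (k : ℕ) : DependsOn ((weighted p q x κ ^ k) u) (Set.Iic x) := by
  induction k with
  | zero => simpa using hu
  | succ k ih =>
    rw [pow_succ', Module.End.mul_apply]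
    exact dependsOn_weighted ih κ

theorem update_eq_of_mem_Iic {x x' : Fin L} (h : (x : ℕ) = x' + 1) (b : Stable L) (v : Bool) :
    ∀ y ∈ Set.Iic x', Function.update b x v y = b y := fun y hy =>
  Function.update_of_ne (fun hyx => by
    have := Fin.le_def.1 (Set.mem_Iic.1 hy)
    rw [hyx] at this
    omega) _ _

/-- The deviation at a site survives an avalanche exactly when its left neighbour does not topple:
otherwise the site receives a fresh coin. -/
theorem weighted_mul_deviation (hpq : p + q = 1) {x x' : Fin L} (h : (x : ℕ) = x' + 1)
    {u : Stable L → ℝ} (hu : DependsOn u (Set.Iic x')) (κ : ℕ → ℝ) :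
    weighted p q x' κ (u * deviation p x) = κ 0 • (quiet p q x' u * deviation p x) := by
  funext r
  have hq : q = 1 - p := by linarith
  rw [weighted_apply, Pi.smul_apply, Pi.mul_apply, weighted_apply]
  have hsum := sum_psi_update hpq x fun b => κ (topplings (inject r).1 b x') *
    (u * deviation p x) (relax (inject r).1 b)
  simp only [smul_eq_mul] at hsum
  rw [hsum, smul_eq_mul, Finset.sum_mul, Finset.mul_sum]
  refine Finset.sum_congr rfl fun b _ => ?_
  have hb := update_eq_of_mem_Iic h b
  have hx : ∀ v, relax (inject r).1 (Function.update b x v) x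
      = settled (topplings (inject r).1 b x') (r x) v := fun v => by
    rw [relax, load_inject r _ h, topplings_congr (fun _ _ => rfl) (hb v), Function.update_self]
    rfl
  simp only [Pi.mul_apply, deviation, hx, topplings_congr (fun _ _ => rfl) (hb _),
    hu (relax_congr (fun _ _ => rfl) (hb _))]
  rcases Nat.eq_zero_or_pos (topplings (inject r).1 b x') with h0 | h0
  · rw [h0, settled_zero, settled_zero, if_pos rfl, hq]
    ring
  · rw [settled_of_pos h0, settled_of_pos h0, if_neg h0.ne', hq]
    simp only [Bool.toNat_true, Bool.toNat_false, Nat.cast_one, Nat.cast_zero]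
    ring

theorem dependsOn_update {x x' : Fin L} (h : (x : ℕ) = x' + 1) {u : Stable L → ℝ}
    (hu : DependsOn u (Set.Iic x')) (b : Stable L) (v : Bool) :
    u (Function.update b x v) = u b :=
  hu (update_eq_of_mem_Iic h b v)

theorem mean_mul_deviation (hpq : p + q = 1) {x x' : Fin L} (h : (x : ℕ) = x' + 1)
    {u : Stable L → ℝ} (hu : DependsOn u (Set.Iic x')) :
    mean p q (u * deviation p x) = 0 := by
  have hq : q = 1 - p := by linarith
  have hsum := sum_psi_update hpq x (u * deviation p x)
  simp only [smul_eq_mul, Pi.mul_apply, dependsOn_update h hu, deviation,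
    Function.update_self] at hsum
  rw [mean_apply]
  simp only [Pi.mul_apply, deviation]
  rw [hsum]
  refine Finset.sum_eq_zero fun b _ => ?_
  rw [hq]
  simp only [Bool.toNat_true, Bool.toNat_false, Nat.cast_one, Nat.cast_zero]
  ring

theorem mean_mul_deviation_sq (hpq : p + q = 1) {x x' : Fin L} (h : (x : ℕ) = x' + 1)
    {u : Stable L → ℝ} (hu : DependsOn u (Set.Iic x')) :
    mean p q (u * deviation p x * deviation p x) = p * q * mean p q u := by
  have hq : q = 1 - p := by linarith
  have hsum := sum_psi_update hpq x (u * deviation p x * deviation p x)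
  simp only [smul_eq_mul, Pi.mul_apply, dependsOn_update h hu, deviation,
    Function.update_self] at hsum
  rw [mean_apply, mean_apply]
  simp only [Pi.mul_apply, deviation]
  rw [hsum, Finset.mul_sum]
  refine Finset.sum_congr rfl fun b _ => ?_
  rw [hq]
  simp only [Bool.toNat_true, Bool.toNat_false, Nat.cast_one, Nat.cast_zero]
  ring

/-- Counting the topplings at `x` amounts to counting those of its left neighbour, up to the change
of the number of stable particles on `x`. -/
theorem counted_succ {x x' : Fin L} (h : (x : ℕ) = x' + 1) (u : Stable L → ℝ) :
    counted p q x u = counted p q x' u + transition p q x' u * deviation p x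
      - transition p q x' (u * deviation p x) := by
  funext r
  simp only [Pi.sub_apply, Pi.add_apply, Pi.mul_apply, weighted_apply, Finset.sum_mul]
  rw [← Finset.sum_add_distrib, ← Finset.sum_sub_distrib]
  refine Finset.sum_congr rfl fun b _ => ?_
  have hc := topplings_add_relax (inject r).1 b x
  rw [load_inject r b h] at hc
  have hc' : (topplings (inject r).1 b x : ℝ) = topplings (inject r).1 b x'
      + ((r x).toNat : ℝ) - ((relax (inject r).1 b x).toNat : ℝ) := by
    have := congrArg (Nat.cast : ℕ → ℝ) hc
    push_cast at this
    have hr : (inject r).1.2 x = r x := rfl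
    rw [hr] at this
    linarith
  rw [hc', deviation, deviation]
  ring

/-- After an avalanche in which the left neighbour topples, the deviation at a site has conditional
mean `0`; without such a toppling the weight vanishes. -/
theorem counted_mul_deviation (hpq : p + q = 1) {x x' : Fin L} (h : (x : ℕ) = x' + 1)
    {u : Stable L → ℝ} (hu : DependsOn u (Set.Iic x')) :
    counted p q x' (u * deviation p x) = 0 := by
  rw [weighted_mul_deviation hpq h hu, Nat.cast_zero, zero_smul]

theorem transition_mul_deviation (hpq : p + q = 1) {x x' : Fin L} (h : (x : ℕ) = x' + 1)
    {u : Stable L → ℝ} (hu : DependsOn u (Set.Iic x')) :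
    transition p q x' (u * deviation p x) = quiet p q x' u * deviation p x := by
  rw [weighted_mul_deviation hpq h hu, one_smul]

theorem transition_pow_mul_deviation (hpq : p + q = 1) {x x' : Fin L} (h : (x : ℕ) = x' + 1)
    {u : Stable L → ℝ} (hu : DependsOn u (Set.Iic x')) (k : ℕ) :
    (transition p q x' ^ k) (u * deviation p x) = (quiet p q x' ^ k) u * deviation p x := by
  induction k with
  | zero => simp
  | succ k ih =>
    rw [pow_succ', Module.End.mul_apply, ih,
      transition_mul_deviation hpq h (dependsOn_weighted_pow hu _ k), pow_succ',
      Module.End.mul_apply]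

/-- The recursion of the two-point function from a site to the next one. With `d` the deviation at
`x`, the only contribution of `d` which does not cancel is the covariance `p * q` between the coin
left at `x` by a first avalanche and its removal by the next one which reaches `x`. -/
theorem mean_counted_succ (hpq : p + q = 1) {x x' : Fin L} (h : (x : ℕ) = x' + 1) (k : ℕ) :
    mean p q (counted p q x ((transition p q x ^ k) (counted p q x 1)))
      = mean p q (counted p q x' ((transition p q x' ^ k) (counted p q x' 1)))
        - p * q * mean p q (active p q x' ((quiet p q x' ^ k) (active p q x' 1))) := by
  have hone : DependsOn (1 : Stable L → ℝ) (Set.Iic x') := fun _ _ _ => rfl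
  set d := deviation p x
  set v := (transition p q x' ^ k) (counted p q x' 1)
  set y := (quiet p q x' ^ k) (active p q x' 1)
  have hv' : DependsOn v (Set.Iic x') := dependsOn_weighted_pow (dependsOn_weighted hone _) _ k
  have hy' : DependsOn y (Set.Iic x') := dependsOn_weighted_pow (dependsOn_weighted hone _) _ k
  have hfirst : counted p q x 1 = counted p q x' 1 + active p q x' 1 * d := by
    have h1 := transition_eq_quiet_add_active (p := p) (q := q) x' 1
    rw [transition_one hpq] at h1
    rw [counted_succ h, transition_mul_deviation hpq h hone, transition_one hpq,
      eq_sub_of_add_eq' h1.symm, sub_mul, add_sub_assoc]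
  have hmid : (transition p q x ^ k) (counted p q x 1) = v + y * d := by
    -- the transition operator does not depend on the site
    rw [show transition p q x = transition p q x' from rfl, hfirst, map_add,
      transition_pow_mul_deviation hpq h (dependsOn_weighted hone _)]
  have hmean : mean p q y = mean p q (quiet p q x' y) + mean p q (active p q x' y) := by
    rw [← map_add, ← transition_eq_quiet_add_active, mean_transition hpq]
  rw [hmid, counted_succ h, map_add (counted p q x'), counted_mul_deviation hpq h hy',
    add_zero, map_add (transition p q x'), transition_mul_deviation hpq h hy', map_sub,
    mean_transition hpq, add_mul, add_mul, map_add, map_add, map_add,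
    mean_mul_deviation hpq h (dependsOn_weighted hv' _), mean_mul_deviation hpq h hv',
    mean_mul_deviation_sq hpq h (dependsOn_weighted hy' _), mean_mul_deviation_sq hpq h hy', hmean]
  ring

end DSS

theorem mainTheorem6 (L : ℕ) (p q : ℝ) (hp : 0 < p) (hq : 0 < q) (hpq : p + q = 1)
    (σ : DSS.EvolutionRule L) :
    (∀ y : Fin L, DSS.W p q σ = DSS.WZero p q σ y + DSS.WPos p q σ y) ∧
    (∀ (y : Fin L) (r r' : DSS.Stable L),
      DSS.WZero p q σ y r' r = DSS.avalancheProb p q σ r r' (fun s => s y = 0) ∧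
      DSS.WPos p q σ y r' r = DSS.avalancheProb p q σ r r' (fun s => 1 ≤ s y)) ∧
    (∀ (x x' : Fin L), (x : ℕ) = (x' : ℕ) + 1 → ∀ t τ : ℕ, 1 ≤ τ →
      DSS.corr p q σ x t τ = DSS.corr p q σ x' t τ
        - p * q * DSS.braId
            ((DSS.WPos p q σ x' * DSS.WZero p q σ x' ^ (τ - 1) * DSS.WPos p q σ x').mulVec
              (DSS.psi p q))) := by
  refine ⟨fun y => ?_, fun y r r' => ⟨DSS.WZero_apply hpq σ y r r', DSS.WPos_apply hpq σ y r r'⟩,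
    fun x x' h t τ hτ => ?_⟩
  · ext r' r
    simp only [Matrix.add_apply, DSS.WZero, DSS.WPos, Matrix.of_apply]
    ring
  · obtain ⟨k, rfl⟩ := Nat.exists_eq_add_of_le' hτ
    rw [Nat.add_sub_cancel, DSS.corr_eq_mean hpq, DSS.corr_eq_mean hpq, DSS.braId_eq_mean hpq,
      DSS.mean_counted_succ hpq h]
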